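/- Let $T\ge 0$, let $|\cdot|$ be the Euclidean norm on $\mathbb{R}^d$, and write $\mathrm{dist}(a,B)=\inf_{b\in B}|a-b|$. Let $f:[0,T]\times\mathbb{R}^d\to\mathbb{R}^d$ be continuous, and let $l_f:[0,T]\to\mathbb{R}$ be a continuous function such that $\langle f(t,x)-f(t,x'),x-x'\rangle\le l_f(t)|x-x'|^2$ for all $t\in[0,T]$ and $x,x'\in\mathbb{R}^d$. Let $M$ assign to each $(t,x)\in[0,T]\times\mathbb{R}^d$ a nonempty convex compact subset $M(t,x)$ of $\mathbb{R}^d$, be continuous with respect to the Hausdorff distance $\mathrm{dist}_H$, and let $L_M:[0,T]\to[0,\infty)$ be a continuous function such that $\mathrm{dist}_H(M(t,x),M(t,x'))\le L_M(t)|x-x'|$ for all $t\in[0,T]$ and $x,x'\in\mathbb{R}^d$. Let $0=t_0<t_1<\dots<t_N=T$, put $h_n:=t_{n+1}-t_n$, and assume that $l_f(t_{n+1})h_n<1$ for $n=0,\dots,N-1$. Then for every sequence $\{x_n\}_{n=0}^N\subset\mathbb{R}^d$ and every initial value $y_0\in\mathbb{R}^d$ there exists a trajectory $\{y_n\}_{n=0}^N$,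 starting at $y_0$, of the parameterized semi-implicit Euler scheme, i.e. a sequence with $$y_{n+1}\in y_n+h_nf(t_{n+1},y_{n+1})+h_nM(t_n,y_n),\qquad n=0,\dots,N-1,$$ such that for all $n=0,\dots,N$ $$|x_n-y_n|\le e^{\sum_{k=0}^{n-1}\left(\frac{l_f(t_{k+1})h_k}{1-l_f(t_{k+1})h_k}+L_M(t_k)h_k\right)}|x_0-y_0|+\sum_{k=0}^{n-1}e^{\sum_{j=k}^{n-1}\frac{l_f(t_{j+1})h_j}{1-l_f(t_{j+1})h_j}+\sum_{j=k+1}^{n-1}L_M(t_j)h_j}\,h_kg_k,$$ where $$g_n:=\mathrm{dist}\Big(\tfrac{1}{h_n}(x_{n+1}-x_n),\ f(t_{n+1},x_{n+1})+M(t_n,x_n)\Big),\qquad n=0,\dots,N-1.$$ -/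

import Mathlib

open Set Finset TopologicalSpace
open scoped Pointwise

namespace SemiImplicitEuler

/-- The state space `ℝ^d` with the Euclidean norm. -/
abbrev State (d : ℕ) : Type := EuclideanSpace ℝ (Fin d)

/-- Hypotheses on the single-valued part `f` on `[0,T] × ℝ^d` (nothing is required outside of
`[0,T]`): `f` is jointly continuous, `l` is continuous on `[0,T]` (hence integrable there), and
`x ↦ f t x` is one-sided Lipschitz with constant `l t`, a real number of arbitrary sign. -/
structure SingleValuedPart {d : ℕ} (T : ℝ) (f : ℝ → State d → State d) (l : ℝ → ℝ) : Prop where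
  continuous_f : ContinuousOn (fun p : ℝ × State d => f p.1 p.2) (Set.Icc 0 T ×ˢ Set.univ)
  continuous_l : ContinuousOn l (Set.Icc 0 T)
  oneSidedLipschitz : ∀ t ∈ Set.Icc 0 T, ∀ x x' : State d,
    inner ℝ (f t x - f t x') (x - x') ≤ l t * ‖x - x'‖ ^ 2

/-- Hypotheses on the set-valued part `M` on `[0,T] × ℝ^d` (nothing is required outside of
`[0,T]`): the values are nonempty, convex and compact, `M` is jointly continuous with respect to
the Hausdorff metric (the metric of `NonemptyCompacts`), `L` is nonnegative and continuous on
`[0,T]` (hence integrable there), and `x ↦ M t x` is Lipschitz with constant `L t`. -/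
structure SetValuedPart {d : ℕ} (T : ℝ) (M : ℝ → State d → NonemptyCompacts (State d))
    (L : ℝ → ℝ) : Prop where
  convex : ∀ t ∈ Set.Icc 0 T, ∀ x : State d, Convex ℝ (M t x : Set (State d))
  continuous_M : ContinuousOn (fun p : ℝ × State d => M p.1 p.2) (Set.Icc 0 T ×ˢ Set.univ)
  continuous_L : ContinuousOn L (Set.Icc 0 T)
  nonneg_L : ∀ t ∈ Set.Icc 0 T, 0 ≤ L t
  lipschitz : ∀ t ∈ Set.Icc 0 T, ∀ x x' : State d,
    Metric.hausdorffDist (M t x : Set (State d)) (M t x' : Set (State d)) ≤ L t * ‖x - x'‖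

/-- `0 = t 0 < t 1 < ⋯ < t N = T`; the values `t n` with `n > N` are irrelevant. -/
structure IsGrid (T : ℝ) (N : ℕ) (t : ℕ → ℝ) : Prop where
  zero : t 0 = 0
  last : t N = T
  lt_succ : ∀ n < N, t n < t (n + 1)

/-- The step size `h n = t (n+1) - t n`. -/
def stepSize (t : ℕ → ℝ) (n : ℕ) : ℝ := t (n + 1) - t n

/-- One step of the parameterized semi-implicit Euler scheme,
`Φ(t,x;h) = {z : z ∈ x + h f(t+h,z) + h M(t,x)}`. -/
def eulerStep {d : ℕ} (f : ℝ → State d → State d) (M : ℝ → State d → NonemptyCompacts (State d))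
    (t : ℝ) (x : State d) (h : ℝ) : Set (State d) :=
  {z | z ∈ {x + h • f (t + h) z} + h • (M t x : Set (State d))}

/-- `y 0, …, y N` is a trajectory of the scheme on the grid `t 0, …, t N` with initial value
`y₀`; the values `y n` with `n > N` are irrelevant. -/
def IsTrajectory {d : ℕ} (f : ℝ → State d → State d)
    (M : ℝ → State d → NonemptyCompacts (State d)) (N : ℕ) (t : ℕ → ℝ) (y₀ : State d)
    (y : ℕ → State d) : Prop :=
  y 0 = y₀ ∧ ∀ n < N, y (n + 1) ∈ eulerStep f M (t n) (y n) (stepSize t n)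

/-- The defect
`g n = dist ((x (n+1) - x n) / h n, f (t (n+1), x (n+1)) + M (t n, x n))`. -/
noncomputable def defect {d : ℕ} (f : ℝ → State d → State d)
    (M : ℝ → State d → NonemptyCompacts (State d)) (t : ℕ → ℝ) (x : ℕ → State d) (n : ℕ) : ℝ :=
  Metric.infDist ((stepSize t n)⁻¹ • (x (n + 1) - x n))
    ({f (t (n + 1)) (x (n + 1))} + (M (t n) (x n) : Set (State d)))

/-- The exponent `l(t (k+1)) h k / (1 - l(t (k+1)) h k)`. -/
noncomputable def implicitRate (l : ℝ → ℝ) (t : ℕ → ℝ) (k : ℕ) : ℝ :=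
  l (t (k + 1)) * stepSize t k / (1 - l (t (k + 1)) * stepSize t k)

end SemiImplicitEuler

/-! The trajectory is chosen step by step to stay near `x`. A nearest point of `f + M` to the
difference quotient of `x` supplies `m ∈ M(t_n, x_n)`. Replace it by a nearest `m' ∈ M(t_n, y_n)`,
at cost `L_M |x_n - y_n|`, and solve `z - h f(t_{n+1}, z) = y_n + h m'`. Since `l h < 1`, the left
side is strongly monotone in `z` with modulus `1 - l h`: this gives a solution
(`IsStronglyMonotone.surjective`) and the error recursion `(1 - l h) e_{n+1} ≤ (1 + L h) e_n + h
g_n`. Exponential bounds and `discrete_gronwall` conclude. -/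

namespace SemiImplicitEuler

/-! ### Surjectivity of strongly monotone maps -/

section StronglyMonotone

open Filter Topology MeasureTheory

variable {E : Type*} [NormedAddCommGroup E] [InnerProductSpace ℝ E]

/-- Strong monotonicity with modulus `μ`. -/
def IsStronglyMonotone (μ : ℝ) (F : E → E) : Prop :=
  ∀ x y : E, μ * ‖x - y‖ ^ 2 ≤ inner ℝ (F x - F y) (x - y)

lemma IsStronglyMonotone.mul_norm_sub_le {μ : ℝ} {F : E → E} (hF : IsStronglyMonotone μ F)
    (x y : E) : μ * ‖x - y‖ ≤ ‖F x - F y‖ := by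
  rcases (norm_nonneg (x - y)).eq_or_lt with h | h
  · rw [← h]; simp
  · have h1 := (hF x y).trans (real_inner_le_norm _ _)
    refine le_of_mul_le_mul_right ?_ h
    linarith [sq ‖x - y‖, mul_assoc μ ‖x - y‖ ‖x - y‖, h1,
      (by ring : μ * ‖x - y‖ ^ 2 = μ * ‖x - y‖ * ‖x - y‖)]

lemma IsStronglyMonotone.le_inner_fderiv {μ : ℝ} {F : E → E} (hF : IsStronglyMonotone μ F)
    {F' : E →L[ℝ] E} {y : E} (h : HasFDerivAt F F' y) (v : E) :
    μ * ‖v‖ ^ 2 ≤ inner ℝ (F' v) v := by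
  have hlim := (h.hasLineDerivAt v).tendsto_slope_zero_right
  have hlim' := hlim.inner (tendsto_const_nhds (x := v)) (𝕜 := ℝ)
  refine ge_of_tendsto hlim' ?_
  filter_upwards [self_mem_nhdsWithin] with s hs
  have hs : (0 : ℝ) < s := hs
  have h1 := hF (y + s • v) y
  simp only [add_sub_cancel_left, norm_smul, Real.norm_eq_abs, abs_of_pos hs,
    inner_smul_right] at h1
  simp only [inner_smul_left, RCLike.conj_to_real]
  rw [← div_eq_inv_mul, le_div_iff₀ hs]
  refine le_of_mul_le_mul_left ?_ hs
  calc s * (μ * ‖v‖ ^ 2 * s) = μ * (s * ‖v‖) ^ 2 := by ring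
    _ ≤ _ := h1

variable [FiniteDimensional ℝ E]

/-- `‖F y - c‖²` is coercive, so it has a minimiser. There its derivative in the direction `v = F y
- c` gives `⟨F' v, v⟩ = 0`, which forces `v = 0`. -/
lemma IsStronglyMonotone.surjective_of_differentiable {μ : ℝ} (hμ : 0 < μ) {F : E → E}
    (hF : IsStronglyMonotone μ F) (hd : Differentiable ℝ F) : Function.Surjective F := by
  intro c
  have hcont : Continuous fun y => ‖F y - c‖ ^ 2 :=
    ((hd.continuous.sub continuous_const).norm).pow 2
  have hcoer : Tendsto (fun y => ‖F y - c‖ ^ 2) (cocompact E) atTop := by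
    refine (tendsto_pow_atTop two_ne_zero).comp ?_
    have h1 : Tendsto (fun y : E => μ * ‖y‖ + -‖F 0 - c‖) (cocompact E) atTop :=
      tendsto_atTop_add_const_right _ _ ((tendsto_norm_cocompact_atTop (E := E)).const_mul_atTop hμ)
    refine tendsto_atTop_mono (fun y => ?_) h1
    have h2 := hF.mul_norm_sub_le y 0
    rw [sub_zero] at h2
    have h3 : ‖F y - F 0‖ ≤ ‖F y - c‖ + ‖F 0 - c‖ := by
      simpa using norm_sub_le (F y - c) (F 0 - c)
    linarith
  obtain ⟨y, hy⟩ := hcont.exists_forall_le hcoer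
  refine ⟨y, ?_⟩
  have hder := (hd y).hasFDerivAt
  have h0 := IsLocalMin.hasFDerivAt_eq_zero (Filter.Eventually.of_forall hy)
    ((hder.sub_const c).norm_sq)
  have h1 := congrArg (fun A : E →L[ℝ] ℝ => A (F y - c)) h0
  have h2 := hF.le_inner_fderiv hder (F y - c)
  simp only [_root_.smul_apply, ContinuousLinearMap.comp_apply,
    _root_.zero_apply, innerSL_apply_apply, smul_eq_zero, two_ne_zero,
    false_or] at h1
  rw [real_inner_comm, h1] at h2
  have h3 : ‖F y - c‖ ^ 2 = 0 :=
    le_antisymm (by by_contra! h; exact absurd h2 (not_le.2 (mul_pos hμ h))) (sq_nonneg _)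
  exact sub_eq_zero.1 (norm_eq_zero.1 (pow_eq_zero_iff two_ne_zero |>.1 h3))

variable [MeasurableSpace E] [BorelSpace E]

open scoped Convolution

/-- Mollifying averages translates of `F` against a probability density, so the modulus `μ`
survives. -/
lemma IsStronglyMonotone.convolution {μ : ℝ} {F : E → E} (hF : IsStronglyMonotone μ F)
    (hc : Continuous F) (φ : ContDiffBump (0 : E)) :
    IsStronglyMonotone μ
      (φ.normed volume ⋆[ContinuousLinearMap.lsmul ℝ ℝ, volume] F) := by
  intro x y
  have hint : ∀ z : E, Integrable (fun t => φ.normed volume t • F (z - t)) := fun z =>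
    (φ.continuous_normed.smul (hc.comp (continuous_const.sub continuous_id))
      ).integrable_of_hasCompactSupport φ.hasCompactSupport_normed.smul_right
  have hφ : ∫ t, φ.normed volume t * (μ * ‖x - y‖ ^ 2) = μ * ‖x - y‖ ^ 2 := by
    rw [integral_mul_const, φ.integral_normed, one_mul]
  simp only [MeasureTheory.convolution, ContinuousLinearMap.lsmul_apply]
  rw [← integral_sub (hint x) (hint y), real_inner_comm,
    ← integral_inner (f := fun t => φ.normed volume t • F (x - t) - φ.normed volume t • F (y - t))
      ((hint x).sub (hint y)), ← hφ]
  refine integral_mono (φ.integrable_normed.mul_const _)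
    (((hint x).sub (hint y)).const_inner _) fun t => ?_
  have h := hF (x - t) (y - t)
  rw [sub_sub_sub_cancel_right] at h
  rw [← smul_sub, inner_smul_right, real_inner_comm]
  exact mul_le_mul_of_nonneg_left h (φ.nonneg_normed t)

/-- A continuous strongly monotone map of a finite-dimensional space is onto. -/
theorem IsStronglyMonotone.surjective {μ : ℝ} (hμ : 0 < μ) {F : E → E}
    (hF : IsStronglyMonotone μ F) (hc : Continuous F) : Function.Surjective F := by
  intro c
  let φ : ℕ → ContDiffBump (0 : E) := fun n =>
    ⟨1 / ((n : ℝ) + 1) / 2, 1 / ((n : ℝ) + 1), by positivity, half_lt_self (by positivity)⟩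
  have hφ : Tendsto (fun n => (φ n).rOut) atTop (𝓝 0) := tendsto_one_div_add_atTop_nhds_zero_nat
  let G : ℕ → E → E := fun n =>
    (φ n).normed volume ⋆[ContinuousLinearMap.lsmul ℝ ℝ, volume] F
  have hG : ∀ n, IsStronglyMonotone μ (G n) := fun n => hF.convolution hc (φ n)
  have hGd : ∀ n, Differentiable ℝ (G n) := fun n =>
    ((φ n).hasCompactSupport_normed.contDiff_convolution_left _ ((φ n).contDiff_normed (n := 1))
      hc.locallyIntegrable).differentiable one_ne_zero
  -- The evaluation points may move, as needed for a convergent subsequence of solutions of `G n y =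
  -- c`.
  have hlim : ∀ (θ : ℕ → ℕ) (k : ℕ → E) (z : E), Tendsto θ atTop atTop →
      Tendsto k atTop (𝓝 z) → Tendsto (fun n => G (θ n) (k n)) atTop (𝓝 (F z)) := by
    intro θ k z hθ hk
    exact ContDiffBump.convolution_tendsto_right (φ := fun n => φ (θ n)) (g := fun _ => F)
      (hφ.comp hθ) (Eventually.of_forall fun _ => hc.aestronglyMeasurable)
      ((hc.tendsto z).comp tendsto_snd) hk
  choose y hy using fun n => (hG n).surjective_of_differentiable hμ (hGd n) c
  obtain ⟨R, hR⟩ := (Metric.isBounded_range_of_tendsto _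
    (hlim id (fun _ => 0) 0 tendsto_id tendsto_const_nhds)).exists_norm_le
  -- The modulus does not depend on `n`, and `G n 0` converges, so the solutions stay bounded.
  have hbd : ∀ n, y n ∈ Metric.closedBall (0 : E) ((‖c‖ + R) / μ) := by
    intro n
    rw [mem_closedBall_zero_iff, le_div_iff₀ hμ, mul_comm]
    have h1 := (hG n).mul_norm_sub_le (y n) 0
    rw [sub_zero, hy n] at h1
    have h2 : ‖G n 0‖ ≤ R := hR _ ⟨n, rfl⟩
    linarith [norm_sub_le c (G n 0)]
  obtain ⟨z, -, θ, hθ, hz⟩ := (isCompact_closedBall (0 : E) ((‖c‖ + R) / μ)).tendsto_subseq hbd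
  refine ⟨z, tendsto_nhds_unique (hlim θ _ z hθ.tendsto_atTop hz) ?_⟩
  simp only [Function.comp_apply, hy]
  exact tendsto_const_nhds

end StronglyMonotone

/-! ### One-step estimate and error accumulation -/

/-- One step of the scheme that follows a prescribed pair `x, x'` with defect `g`. -/
lemma exists_eulerStep_near {d : ℕ} {f : ℝ → State d → State d}
    {M : ℝ → State d → TopologicalSpace.NonemptyCompacts (State d)} {t h l L : ℝ} (hh : 0 < h)
    (hlh : l * h < 1) (hfc : Continuous (f (t + h)))
    (hfl : ∀ x x' : State d,
      inner ℝ (f (t + h) x - f (t + h) x') (x - x') ≤ l * ‖x - x'‖ ^ 2)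
    (hM : ∀ x x' : State d,
      Metric.hausdorffDist (M t x : Set (State d)) (M t x' : Set (State d)) ≤ L * ‖x - x'‖)
    (x x' y : State d) :
    ∃ y' ∈ eulerStep f M t y h,
      (1 - l * h) * ‖x' - y'‖ ≤ (1 + L * h) * ‖x - y‖ + h *
        Metric.infDist (h⁻¹ • (x' - x)) ({f (t + h) x'} + (M t x : Set (State d))) := by
  obtain ⟨p, hp, hpd⟩ :=
    ((isCompact_singleton (x := f (t + h) x')).add (M t x).isCompact).exists_infDist_eq_dist
      ((Set.singleton_nonempty _).add (M t x).nonempty) (h⁻¹ • (x' - x))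
  obtain ⟨_, rfl, m, hm, rfl⟩ := Set.mem_add.1 hp
  obtain ⟨m', hm', hmd⟩ := (M t y).isCompact.exists_infDist_eq_dist (M t y).nonempty m
  have hmm : ‖m - m'‖ ≤ L * ‖x - y‖ := by
    rw [← dist_eq_norm, ← hmd]
    exact (Metric.infDist_le_hausdorffDist_of_mem hm
      (Metric.hausdorffEDist_ne_top_of_nonempty_of_bounded (M t x).nonempty (M t y).nonempty
        (M t x).isCompact.isBounded (M t y).isCompact.isBounded)).trans (hM x y)
  have hmono : IsStronglyMonotone (1 - l * h) fun z => z - h • f (t + h) z := by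
    intro u v
    have e : u - h • f (t + h) u - (v - h • f (t + h) v)
        = (u - v) - h • (f (t + h) u - f (t + h) v) := by
      rw [smul_sub]; abel
    simp only [e]
    rw [inner_sub_left, real_inner_self_eq_norm_sq, real_inner_smul_left]
    linarith [mul_le_mul_of_nonneg_left (hfl u v) hh.le]
  obtain ⟨y', hy'⟩ := hmono.surjective (by linarith)
    (continuous_id.sub (hfc.const_smul h)) (y + h • m')
  refine ⟨y', Set.mem_add.2 ⟨_, rfl, h • m', Set.smul_mem_smul_set hm', ?_⟩, ?_⟩
  · rw [add_right_comm, ← hy', sub_add_cancel]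
  · have h1 := hmono.mul_norm_sub_le x' y'
    simp only [hy'] at h1
    -- The residual splits into old error, change of `M`, and defect.
    have e : x' - h • f (t + h) x' - (y + h • m')
        = ((x - y) + h • (m - m')) + h • (h⁻¹ • (x' - x) - (f (t + h) x' + m)) := by
      rw [smul_sub h (h⁻¹ • _), smul_inv_smul₀ hh.ne']
      module
    rw [e] at h1
    have h2 := norm_add₃_le (a := x - y) (b := h • (m - m'))
      (c := h • (h⁻¹ • (x' - x) - (f (t + h) x' + m)))
    rw [norm_smul, norm_smul, Real.norm_of_nonneg hh.le] at h2
    rw [hpd, dist_eq_norm]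
    linarith [mul_le_mul_of_nonneg_left hmm hh.le]

/-- A discrete Gronwall inequality. -/
lemma discrete_gronwall {N : ℕ} {e r a b : ℕ → ℝ}
    (h : ∀ n < N, e (n + 1) ≤ Real.exp (r n + a n) * e n + Real.exp (r n) * b n) :
    ∀ n ≤ N, e n ≤ Real.exp (∑ k ∈ Finset.range n, (r k + a k)) * e 0
      + ∑ k ∈ Finset.range n, Real.exp ((∑ j ∈ Finset.Ico k n, r j)
          + (∑ j ∈ Finset.Ico (k + 1) n, a j)) * b k := by
  intro n
  induction n with
  | zero => intro _; simp
  | succ n ih =>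
    intro hn
    refine (h n hn).trans ?_
    have h1 := mul_le_mul_of_nonneg_left (ih (Nat.le_of_succ_le hn)) (Real.exp_nonneg (r n + a n))
    -- The factor `exp (r n + a n)` extends both inner sums; the new term `k = n` carries only `exp
    -- (r n)`.
    have h2 : ∑ k ∈ Finset.range n, Real.exp ((∑ j ∈ Finset.Ico k (n + 1), r j)
          + (∑ j ∈ Finset.Ico (k + 1) (n + 1), a j)) * b k
        = Real.exp (r n + a n) * ∑ k ∈ Finset.range n, Real.exp ((∑ j ∈ Finset.Ico k n, r j)
          + (∑ j ∈ Finset.Ico (k + 1) n, a j)) * b k := by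
      rw [Finset.mul_sum]
      refine Finset.sum_congr rfl fun k hk => ?_
      have hk := Finset.mem_range.1 hk
      rw [Finset.sum_Ico_succ_top hk.le, Finset.sum_Ico_succ_top hk, ← mul_assoc, ← Real.exp_add]
      congr 2
      ring
    rw [Finset.sum_range_succ (fun k => r k + a k), Finset.sum_range_succ, h2,
      Real.exp_add (∑ k ∈ Finset.range n, (r k + a k)),
      Finset.Ico_self, Finset.sum_empty, add_zero, Nat.Ico_succ_singleton, Finset.sum_singleton]
    linarith

lemma IsGrid.mem_Icc {T : ℝ} {N : ℕ} {t : ℕ → ℝ} (ht : IsGrid T N t) {n : ℕ} (hn : n ≤ N) :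
    t n ∈ Set.Icc 0 T := by
  have hmono : ∀ m ≤ N, ∀ k ≤ m, t k ≤ t m := by
    intro m
    induction m with
    | zero => intro _ k hk; rw [Nat.le_zero.1 hk]
    | succ m ih =>
      intro hm k hk
      rcases Nat.le_succ_iff.1 hk with h | h
      · exact (ih (by omega) k h).trans (ht.lt_succ m hm).le
      · rw [h]
  exact ⟨ht.zero ▸ hmono n hn 0 (Nat.zero_le n), ht.last ▸ hmono N le_rfl n hn⟩

/-- Apply `1 + u ≤ exp u` to `u = s / (1 - s)`; `s` may be negative. -/
lemma inv_one_sub_le_exp {s : ℝ} (hs : s < 1) : (1 - s)⁻¹ ≤ Real.exp (s / (1 - s)) := by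
  have h : (1 - s) ≠ 0 := by linarith
  calc (1 - s)⁻¹ = s / (1 - s) + 1 := by field_simp; ring
    _ ≤ _ := Real.add_one_le_exp _

end SemiImplicitEuler

theorem proposition15 {d : ℕ} (T : ℝ)
    (f : ℝ → SemiImplicitEuler.State d → SemiImplicitEuler.State d) (l_f : ℝ → ℝ)
    (hf : SemiImplicitEuler.SingleValuedPart T f l_f)
    (M : ℝ → SemiImplicitEuler.State d →
      TopologicalSpace.NonemptyCompacts (SemiImplicitEuler.State d)) (L_M : ℝ → ℝ)
    (hM : SemiImplicitEuler.SetValuedPart T M L_M)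
    (N : ℕ) (t : ℕ → ℝ) (ht : SemiImplicitEuler.IsGrid T N t)
    (hstep : ∀ n < N, l_f (t (n + 1)) * SemiImplicitEuler.stepSize t n < 1)
    (x : ℕ → SemiImplicitEuler.State d) (y₀ : SemiImplicitEuler.State d) :
    ∃ y : ℕ → SemiImplicitEuler.State d,
      SemiImplicitEuler.IsTrajectory f M N t y₀ y ∧
      ∀ n ≤ N,
        ‖x n - y n‖ ≤
          Real.exp (∑ k ∈ Finset.range n,
              (SemiImplicitEuler.implicitRate l_f t k
                + L_M (t k) * SemiImplicitEuler.stepSize t k)) * ‖x 0 - y 0‖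
          + ∑ k ∈ Finset.range n,
              Real.exp ((∑ j ∈ Finset.Ico k n, SemiImplicitEuler.implicitRate l_f t j)
                + (∑ j ∈ Finset.Ico (k + 1) n, L_M (t j) * SemiImplicitEuler.stepSize t j))
              * SemiImplicitEuler.stepSize t k * SemiImplicitEuler.defect f M t x k := by
  have hh : ∀ n < N, 0 < SemiImplicitEuler.stepSize t n := fun n hn => sub_pos.2 (ht.lt_succ n hn)
  have hadd : ∀ n, t n + SemiImplicitEuler.stepSize t n = t (n + 1) := fun n =>
    add_sub_cancel _ _
  -- Placing `n < N` under the existential makes the chosen step a total function, ready for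
  -- recursion.
  have key : ∀ (n : ℕ) (y : SemiImplicitEuler.State d), ∃ y' : SemiImplicitEuler.State d,
      n < N → y' ∈ SemiImplicitEuler.eulerStep f M (t n) y (SemiImplicitEuler.stepSize t n) ∧
        ‖x (n + 1) - y'‖ ≤
          Real.exp (SemiImplicitEuler.implicitRate l_f t n
            + L_M (t n) * SemiImplicitEuler.stepSize t n) * ‖x n - y‖
          + Real.exp (SemiImplicitEuler.implicitRate l_f t n)
            * (SemiImplicitEuler.stepSize t n * SemiImplicitEuler.defect f M t x n) := by
    intro n y
    by_cases hn : n < N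
    swap
    · exact ⟨0, fun h => absurd h hn⟩
    have ht' := ht.mem_Icc hn
    have hfc : Continuous (f (t (n + 1))) :=
      hf.continuous_f.comp_continuous (f := fun z => (t (n + 1), z)) (by fun_prop)
        fun z => ⟨ht', Set.mem_univ z⟩
    obtain ⟨y', hy', hle⟩ := SemiImplicitEuler.exists_eulerStep_near (f := f) (M := M)
      (t := t n) (l := l_f (t (n + 1))) (L := L_M (t n)) (hh n hn) (hstep n hn)
      (by rwa [hadd]) (by rw [hadd]; exact hf.oneSidedLipschitz _ ht')
      (hM.lipschitz _ (ht.mem_Icc hn.le)) (x n) (x (n + 1)) y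
    refine ⟨y', fun _ => ⟨hy', ?_⟩⟩
    rw [hadd] at hle
    have hpos : 0 < 1 - l_f (t (n + 1)) * SemiImplicitEuler.stepSize t n :=
      sub_pos.2 (hstep n hn)
    have hg : 0 ≤ SemiImplicitEuler.defect f M t x n := Metric.infDist_nonneg
    have hL : 1 + L_M (t n) * SemiImplicitEuler.stepSize t n
        ≤ Real.exp (L_M (t n) * SemiImplicitEuler.stepSize t n) := by
      linarith [Real.add_one_le_exp (L_M (t n) * SemiImplicitEuler.stepSize t n)]
    rw [mul_comm, ← le_div_iff₀ hpos, div_eq_inv_mul] at hle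
    have hnn : 0 ≤ Real.exp (L_M (t n) * SemiImplicitEuler.stepSize t n) * ‖x n - y‖
        + SemiImplicitEuler.stepSize t n * SemiImplicitEuler.defect f M t x n :=
      add_nonneg (by positivity) (mul_nonneg (hh n hn).le hg)
    calc ‖x (n + 1) - y'‖ ≤ _ := hle
      _ ≤ (1 - l_f (t (n + 1)) * SemiImplicitEuler.stepSize t n)⁻¹
          * (Real.exp (L_M (t n) * SemiImplicitEuler.stepSize t n) * ‖x n - y‖
            + SemiImplicitEuler.stepSize t n * SemiImplicitEuler.defect f M t x n) :=
        mul_le_mul_of_nonneg_left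
          (add_le_add_left (mul_le_mul_of_nonneg_right hL (norm_nonneg _)) _) (inv_pos.2 hpos).le
      _ ≤ Real.exp (SemiImplicitEuler.implicitRate l_f t n)
          * (Real.exp (L_M (t n) * SemiImplicitEuler.stepSize t n) * ‖x n - y‖
            + SemiImplicitEuler.stepSize t n * SemiImplicitEuler.defect f M t x n) :=
        mul_le_mul_of_nonneg_right (SemiImplicitEuler.inv_one_sub_le_exp (hstep n hn)) hnn
      _ = _ := by rw [Real.exp_add]; ring
  choose Y hY using key
  let y : ℕ → SemiImplicitEuler.State d := fun n => Nat.rec y₀ Y n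
  refine ⟨y, ⟨rfl, fun n hn => (hY n (y n) hn).1⟩, ?_⟩
  simpa only [mul_assoc] using SemiImplicitEuler.discrete_gronwall (e := fun n => ‖x n - y n‖)
    (r := SemiImplicitEuler.implicitRate l_f t)
    (a := fun n => L_M (t n) * SemiImplicitEuler.stepSize t n)
    (b := fun n => SemiImplicitEuler.stepSize t n * SemiImplicitEuler.defect f M t x n)
    fun n hn => (hY n (y n) hn).2
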